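/- Let $\nabla_1>0$ and $t\ge 3$ be integers. For a finite simple graph $G$, let $\gamma(G)$ be the minimum size of a dominating set of $G$, and let $\nabla_1(G)$ be the maximum of $|E(H)|/|V(H)|$ over all $1$-shallow minors $H$ of $G$, that is, over all nonempty graphs $H$ obtained from $G$ by deleting vertices and edges and then contracting pairwise disjoint stars. There exist a deterministic LOCAL algorithm $\mathcal A$ and a function $C\colon\mathbb{R}\to\mathbb{N}$ (both depending only on $\nabla_1$ and $t$) such that for every finite graph $G$ that does not contain the complete bipartite graph $K_{3,t}$ as a subgraph and satisfies $\nabla_1(G)\le\nabla_1$, and for every $\epsilon>0$, the algorithm $\mathcal A$ computes on $G$, for every port numbering and every assignment of pairwise distinct natural numbers as identifiers, in at most $C(\epsilon)$ communication rounds a dominating set of $G$ of size at most $(6\nabla_1+3)\,\gamma(G)$. Here, in the LOCAL model, every vertex of $G$ is a node that initially knows only its degree and its identifier; in each synchronous round every node sends a message of unbounded size to each neighbour (its neighbours being numbered by an arbitrary port numbering, and possibly different messages going to different neighbours), receives the messages of its neighbours, and performs unbounded local computation; each node finally stops and outputs whether it belongs to the computed set. -/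

import Mathlib

namespace DistDom

/-! ### Dominating sets -/

/-- `D` is a dominating set of `G`: `N[D] = V(G)`. -/
def IsDominating {V : Type*} (G : SimpleGraph V) (D : Finset V) : Prop :=
  ∀ v, v ∈ D ∨ ∃ u ∈ D, G.Adj u v

/-- The domination number `γ(G)`: the least size of a dominating set of `G`. -/
noncomputable def domNumber {V : Type*} (G : SimpleGraph V) : ℕ :=
  sInf {k | ∃ D : Finset V, IsDominating G D ∧ D.card = k}

/-- In a finite graph the minimum is attained. -/
theorem exists_isDominating_card_eq {V : Type*} [Fintype V] (G : SimpleGraph V) :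
    ∃ D : Finset V, IsDominating G D ∧ D.card = domNumber G :=
  Nat.sInf_mem (s := {k | ∃ D : Finset V, IsDominating G D ∧ D.card = k})
    ⟨_, Finset.univ, fun v => Or.inl (Finset.mem_univ v), rfl⟩

/-! ### Shallow minors of depth one -/

/-- `H` is a `1`-shallow minor of `G`: there are pairwise disjoint branch sets `B w` in `G`, each of
which is spanned by a star with centre `c w` (that is, induces a connected subgraph of radius at
most one), such that every edge `uw` of `H` is realised by an edge of `G` between `B u` and `B w`. -/
def IsOneShallowMinor {W V : Type*} (H : SimpleGraph W) (G : SimpleGraph V) : Prop :=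
  ∃ (B : W → Set V) (c : W → V),
    (∀ w, c w ∈ B w) ∧
    (∀ w, ∀ x ∈ B w, x = c w ∨ G.Adj (c w) x) ∧
    (∀ u w, u ≠ w → Disjoint (B u) (B w)) ∧
    (∀ u w, H.Adj u w → ∃ x ∈ B u, ∃ y ∈ B w, G.Adj x y)

/-- The edge densities `|E(H)| / |V(H)|` of the nonempty `1`-shallow minors `H` of `G`. -/
def shallowDensities {V : Type*} (G : SimpleGraph V) : Set ℝ :=
  {x | ∃ n : ℕ, 0 < n ∧ ∃ H : SimpleGraph (Fin n),
    IsOneShallowMinor H G ∧ x = (H.edgeSet.ncard : ℝ) / (n : ℝ)}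

/-- A finite graph has only finitely many such densities, so their supremum is a maximum as soon as
the graph has a vertex. -/
theorem finite_shallowDensities {V : Type*} [Fintype V] (G : SimpleGraph V) :
    (shallowDensities G).Finite := by
  have hfin : (⋃ n ∈ Set.Iic (Fintype.card V),
      Set.range fun H : SimpleGraph (Fin n) => (H.edgeSet.ncard : ℝ) / (n : ℝ)).Finite :=
    (Set.finite_Iic _).biUnion fun n _ => Set.finite_range _
  refine hfin.subset ?_
  rintro x ⟨n, -, H, ⟨B, c, hc, -, hd, -⟩, rfl⟩
  have hinj : Function.Injective c := by
    intro u w h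
    by_contra hne
    exact Set.disjoint_left.mp (hd u w hne) (hc u) (h ▸ hc w)
  have hn : n ≤ Fintype.card V := by simpa using Fintype.card_le_of_injective c hinj
  exact Set.mem_biUnion (Set.mem_Iic.mpr hn) ⟨H, rfl⟩

/-- `∇₁(G)`, the maximum edge density of a `1`-shallow minor of the finite graph `G`
(and `0` for the graph without vertices). -/
noncomputable def nablaOne {V : Type*} (G : SimpleGraph V) : ℝ :=
  sSup (shallowDensities G)

/-! ### The LOCAL model -/

/-- A deterministic algorithm of the LOCAL model that selects a set of vertices. Initially a node
knows only its degree `d` and its identifier. In every synchronous round it sends one message (of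
unbounded size) through each of its ports `0, …, d - 1`, receives one message through each port, and
updates its state (by unbounded local computation). A node whose state carries an output has stopped:
its state does not change any more. The output says whether the node joins the set. -/
structure LocalAlgorithm where
  /-- local states -/
  State : Type
  /-- messages -/
  Msg : Type
  /-- initial state of a node, from its degree and its identifier -/
  init : (d : ℕ) → (ident : ℕ) → State
  /-- the message sent through each port -/
  send : (d : ℕ) → State → Fin d → Msg
  /-- the new state, from the messages received through the ports -/
  receive : (d : ℕ) → State → (Fin d → Msg) → State
  /-- the output of a node, if it has stopped -/
  output : State → Option Bool
  /-- stopped nodes stay as they are -/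
  receive_of_stopped : ∀ (d : ℕ) (s : State) (m : Fin d → Msg),
    (output s).isSome → receive d s m = s

/-- A port numbering: every node numbers its incident edges (equivalently, its neighbours). -/
abbrev PortNumbering {V : Type*} (G : SimpleGraph V) [G.LocallyFinite] :=
  ∀ v : V, Fin (G.degree v) ≃ G.neighborSet v

namespace LocalAlgorithm

/-- The state of every node after `r` rounds. If port `i` of `v` leads to `u`, then `v` receives
through it the message that `u` sends through the port of `u` that leads to `v`. -/
def run (A : LocalAlgorithm) {V : Type*} (G : SimpleGraph V) [G.LocallyFinite]
    (p : PortNumbering G) (ident : V → ℕ) : ℕ → V → A.State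
  | 0, v => A.init (G.degree v) (ident v)
  | r + 1, v => A.receive (G.degree v) (run A G p ident r v) fun i =>
      A.send (G.degree (p v i).1) (run A G p ident r (p v i).1)
        ((p (p v i).1).symm ⟨v, (p v i).2.symm⟩)

/-- On the network `G` with ports `p` and identifiers `ident`, all nodes have stopped after at most
`r` communication rounds, and the nodes that answer `true` are those in `D`. -/
def ComputesWithin (A : LocalAlgorithm) {V : Type*} (G : SimpleGraph V) [G.LocallyFinite]
    (p : PortNumbering G) (ident : V → ℕ) (r : ℕ) (D : Finset V) : Prop :=
  ∀ v, ∃ b : Bool, A.output (A.run G p ident r v) = some b ∧ (b = true ↔ v ∈ D)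

end LocalAlgorithm

end DistDom

/-! Write k for the density bound and D for a minimum dominating set. The selected set has three
layers, each charged to D, and membership in each is decided by a ball of constant radius. Contract
the vertices outside X ∪ D onto their dominators in D. The result is a 1-shallow minor, so its
sparsity bounds |X| once every vertex of X has large degree there
(`mul_card_le_of_le_card_starNbhd`). For hard vertices, degree above 2k is automatic: a smaller
contracted neighbourhood would be a cover by at most 2k vertices. For crowded vertices,
K_{3,t}-freeness gives each d in D at most 2k twins; a remaining crowded vertex outside D shares few
residual neighbours with any d, so its contracted degree is at least 3k. These two layers cost at
most (3k+2)|D| (`card_preselected_le`). Every closed neighbourhood now contains boundedly many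
undominated vertices, so a primal-dual scheme with constantly many rounds finishes. Sparsity bounds
its cover from above by the dual value (`mul_card_coverSet_le`), and weak duality bounds the dual
value by a multiple of |D| (`sum_dual_le_mul_card`). -/

namespace DistDom

/-! ### Pair counts in sparse relations -/

section Counting

open scoped Classical

variable {V : Type*}

/-- The number of ordered pairs in `S × T` that are related by `r`. -/
noncomputable def pairCount (r : V → V → Prop) (S T : Finset V) : ℕ :=
  ((S ×ˢ T).filter fun q => r q.1 q.2).card

theorem pairCount_eq_sum_left (r : V → V → Prop) (S T : Finset V) :
    pairCount r S T = ∑ u ∈ S, (T.filter fun w => r u w).card := by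
  rw [pairCount, Finset.card_filter, Finset.sum_product]
  simp only [Finset.card_filter]

theorem pairCount_eq_sum_right (r : V → V → Prop) (S T : Finset V) :
    pairCount r S T = ∑ w ∈ T, (S.filter fun u => r u w).card := by
  rw [pairCount, Finset.card_filter, Finset.sum_product_right]
  simp only [Finset.card_filter]

theorem pairCount_comm {r : V → V → Prop} (hr : ∀ u w, r u w → r w u) (S T : Finset V) :
    pairCount r S T = pairCount r T S := by
  rw [pairCount_eq_sum_left, pairCount_eq_sum_right]
  refine Finset.sum_congr rfl fun u _ => ?_
  congr 1
  ext w
  simp only [Finset.mem_filter]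
  exact ⟨fun h => ⟨h.1, hr _ _ h.2⟩, fun h => ⟨h.1, hr _ _ h.2⟩⟩

/-- If a symmetric relation has density at most `k` on all sets, then the number of related pairs
between two sets is at most `k` times the sum of their sizes. -/
theorem pairCount_le {r : V → V → Prop} (hr : ∀ u w, r u w → r w u) {k : ℕ} {W : Finset V}
    (hk : ∀ S ⊆ W, pairCount r S S ≤ 2 * k * S.card) {S T : Finset V} (hS : S ⊆ W) (hT : T ⊆ W) :
    pairCount r S T ≤ k * (S.card + T.card) := by
  have h1 := hk (S ∪ T) (Finset.union_subset hS hT)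
  have h2 := hk (S ∩ T) (Finset.inter_subset_left.trans hS)
  have h3 := Finset.card_union_add_card_inter S T
  have h4 := pairCount_comm hr S T
  -- S × T and T × S both lie in the square of S ∪ T, and their overlap is the square of S ∩ T. This
  -- permits S and T to intersect.
  have h5 : pairCount r S T + pairCount r T S ≤
      pairCount r (S ∪ T) (S ∪ T) + pairCount r (S ∩ T) (S ∩ T) := by
    unfold pairCount
    rw [← Finset.card_union_add_card_inter]
    refine add_le_add (Finset.card_le_card ?_) (Finset.card_le_card ?_)
    · intro q
      simp only [Finset.mem_union, Finset.mem_filter, Finset.mem_product]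
      tauto
    · intro q
      simp only [Finset.mem_inter, Finset.mem_filter, Finset.mem_product]
      tauto
  have h6 : 2 * k * (S ∪ T).card + 2 * k * (S ∩ T).card = 2 * (k * (S.card + T.card)) := by
    rw [← h3]; ring
  omega

/-- Weighted form of `pairCount_le`. -/
theorem sum_weight_le [Fintype V] {r : V → V → Prop} (hr : ∀ u w, r u w → r w u) {k : ℕ}
    (hk : ∀ S, pairCount r S S ≤ 2 * k * S.card) (S U : Finset V) (y : V → ℕ) (c : ℕ)
    (hy : ∀ u, y u ≤ c) :
    ∑ v ∈ S, ∑ u ∈ U.filter (fun u => r v u), y u ≤ c * k * S.card + k * ∑ u ∈ U, y u := by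
  have h1 : ∑ v ∈ S, ∑ u ∈ U.filter (fun u => r v u), y u
      = ∑ u ∈ U, (S.filter fun v => r v u).card * y u := by
    simp only [Finset.sum_filter, Finset.card_filter, Finset.sum_mul]
    rw [Finset.sum_comm]
    simp
  set e : V → ℕ := fun u => (S.filter fun v => r v u).card with he
  set P := U.filter fun u => k < e u with hP
  have h2 : ∑ u ∈ P, e u ≤ k * (S.card + P.card) := by
    rw [he, ← pairCount_eq_sum_right]
    exact pairCount_le hr (W := Finset.univ) (fun S _ => hk S) (Finset.subset_univ _)
      (Finset.subset_univ _)
  -- Only degrees above k cost extra, and their total excess is at most k|S|. Below, the bound y ≤ c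
  -- is spent on this excess alone.
  have h3 : ∑ u ∈ P, (e u - k) ≤ k * S.card := by
    have : ∑ u ∈ P, (e u - k) + ∑ u ∈ P, k = ∑ u ∈ P, e u := by
      rw [← Finset.sum_add_distrib]
      refine Finset.sum_congr rfl fun u hu => ?_
      have := (Finset.mem_filter.mp hu).2
      omega
    rw [Finset.sum_const, smul_eq_mul] at this
    nlinarith
  have h4 : ∑ u ∈ U, (e u - k) = ∑ u ∈ P, (e u - k) := by
    rw [hP, Finset.sum_filter]
    refine Finset.sum_congr rfl fun u _ => ?_
    split_ifs <;> omega
  rw [h1]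
  calc ∑ u ∈ U, e u * y u ≤ ∑ u ∈ U, (c * (e u - k) + k * y u) := by
        refine Finset.sum_le_sum fun u _ => ?_
        have h5 : e u ≤ (e u - k) + k := by omega
        have := hy u
        nlinarith [Nat.zero_le (e u - k), Nat.zero_le (y u), Nat.mul_le_mul_right (y u) h5,
          Nat.mul_le_mul_left (e u - k) this]
    _ = c * ∑ u ∈ U, (e u - k) + k * ∑ u ∈ U, y u := by
        rw [Finset.sum_add_distrib, Finset.mul_sum, Finset.mul_sum]
    _ ≤ _ := by
        rw [h4, mul_assoc]
        gcongr

/-! ### Star contractions as shallow minors -/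

theorem IsDominating.exists_dom {G : SimpleGraph V} {D : Finset V} (hD : IsDominating G D) :
    ∃ dom : V → V, ∀ u, u ∉ D → dom u ∈ D ∧ G.Adj (dom u) u := by
  have h : ∀ u, ∃ d, u ∉ D → d ∈ D ∧ G.Adj d u := by
    intro u
    rcases hD u with h | ⟨d, hd⟩
    · exact ⟨u, fun h' => absurd h h'⟩
    · exact ⟨d, fun _ => hd⟩
  exact ⟨fun u => (h u).choose, fun u => (h u).choose_spec⟩

theorem ncard_edgeSet_le_of_isOneShallowMinor [Fintype V] {G : SimpleGraph V} {k : ℕ}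
    (hG : nablaOne G ≤ (k : ℝ)) {n : ℕ} {H : SimpleGraph (Fin n)} (hH : IsOneShallowMinor H G) :
    H.edgeSet.ncard ≤ k * n := by
  rcases Nat.eq_zero_or_pos n with rfl | hn
  · have : H.edgeSet = ∅ := by
      rw [SimpleGraph.edgeSet_eq_empty]
      exact Subsingleton.elim _ _
    simp [this]
  · have h := (le_csSup (finite_shallowDensities G).bddAbove ⟨n, hn, H, hH, rfl⟩).trans hG
    rw [div_le_iff₀ (by exact_mod_cast hn)] at h
    exact_mod_cast h

/-- Adjacency of branch sets. -/
def BranchAdj (G : SimpleGraph V) (B : V → Set V) (u w : V) : Prop :=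
  u ≠ w ∧ ∃ x ∈ B u, ∃ y ∈ B w, G.Adj x y

theorem BranchAdj.symm {G : SimpleGraph V} {B : V → Set V} (u w : V) (h : BranchAdj G B u w) :
    BranchAdj G B w u := by
  obtain ⟨hne, x, hx, y, hy, hxy⟩ := h
  exact ⟨hne.symm, y, hy, x, hx, hxy.symm⟩

/-- The branch sets `B w`, for `w ∈ W`, are pairwise disjoint stars with centre `w`. -/
structure IsStarSystem (G : SimpleGraph V) (W : Finset V) (B : V → Set V) : Prop where
  mem_self : ∀ w ∈ W, w ∈ B w
  eq_or_adj : ∀ w ∈ W, ∀ x ∈ B w, x = w ∨ G.Adj w x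
  disjoint : ∀ u ∈ W, ∀ w ∈ W, u ≠ w → Disjoint (B u) (B w)

theorem IsStarSystem.mono {G : SimpleGraph V} {W S : Finset V} {B : V → Set V}
    (h : IsStarSystem G W B) (hS : S ⊆ W) : IsStarSystem G S B :=
  ⟨fun w hw => h.1 w (hS hw), fun w hw => h.2 w (hS hw),
    fun u hu w hw => h.3 u (hS hu) w (hS hw)⟩

/-- Contracting the stars gives a 1-shallow minor on S. Ordered adjacent pairs are its degree sum,
hence twice its number of edges. -/
theorem IsStarSystem.pairCount_self_le [Fintype V] {G : SimpleGraph V} {k : ℕ} (hG : nablaOne G ≤ (k : ℝ))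
    {S : Finset V} {B : V → Set V} (h : IsStarSystem G S B) :
    pairCount (BranchAdj G B) S S ≤ 2 * k * S.card := by
  let e := S.equivFin.symm
  let H : SimpleGraph (Fin S.card) :=
    { Adj := fun i j => BranchAdj G B (e i) (e j)
      symm := ⟨fun _ _ => BranchAdj.symm _ _⟩
      loopless := ⟨fun _ hi => hi.1 rfl⟩ }
  have hH : IsOneShallowMinor H G := by
    refine ⟨fun i => B (e i), fun i => e i, fun i => h.1 _ (e i).2, fun i => h.2 _ (e i).2,
      fun i j hij => h.3 _ (e i).2 _ (e j).2 ?_, fun i j hij => hij.2⟩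
    exact fun hh => hij (e.injective (Subtype.ext hh))
  have h1 := ncard_edgeSet_le_of_isOneShallowMinor hG hH
  have h2 := H.sum_degrees_eq_twice_card_edges
  have h3 : H.edgeFinset.card = H.edgeSet.ncard := by
    rw [← SimpleGraph.coe_edgeFinset, Set.ncard_coe_finset]
  have h4 : pairCount (BranchAdj G B) S S = ∑ i, H.degree i := by
    rw [pairCount_eq_sum_left, ← Finset.sum_coe_sort S,
      ← Equiv.sum_comp e]
    refine Finset.sum_congr rfl fun i _ => ?_
    rw [← SimpleGraph.card_neighborFinset_eq_degree]
    symm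
    refine Finset.card_bij (fun j _ => (e j : V)) ?_ ?_ ?_
    · intro j hj
      rw [SimpleGraph.mem_neighborFinset] at hj
      exact Finset.mem_filter.mpr ⟨(e j).2, hj⟩
    · intro a _ b _ hab
      exact e.injective (Subtype.ext hab)
    · intro w hw
      obtain ⟨hwS, hw⟩ := Finset.mem_filter.mp hw
      refine ⟨e.symm ⟨w, hwS⟩, ?_, by simp⟩
      rw [SimpleGraph.mem_neighborFinset]
      change BranchAdj G B _ (e (e.symm ⟨w, hwS⟩))
      simpa using hw
  rw [h4, h2, h3]
  nlinarith

theorem IsStarSystem.pairCount_le [Fintype V] {G : SimpleGraph V} {k : ℕ} (hG : nablaOne G ≤ (k : ℝ))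
    {W : Finset V} {B : V → Set V} (h : IsStarSystem G W B) {S T : Finset V}
    (hS : S ⊆ W) (hT : T ⊆ W) :
    pairCount (BranchAdj G B) S T ≤ k * (S.card + T.card) :=
  DistDom.pairCount_le BranchAdj.symm (fun _ hU => (h.mono hU).pairCount_self_le hG) hS hT

theorem pairCount_adj_self_le [Fintype V] {G : SimpleGraph V} {k : ℕ} (hG : nablaOne G ≤ (k : ℝ))
    (S : Finset V) : pairCount G.Adj S S ≤ 2 * k * S.card := by
  have h : IsStarSystem G S fun v => {v} :=
    ⟨fun _ _ => rfl, fun _ _ _ hx => Or.inl hx, fun _ _ _ _ hne => by simpa using hne⟩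
  have h2 : BranchAdj G (fun v => {v}) = G.Adj := by
    ext u w
    simp only [BranchAdj, Set.mem_singleton_iff, exists_eq_left, and_iff_right_iff_imp]
    exact fun h => h.ne
  simpa [h2] using h.pairCount_self_le hG

/-- Contracting the vertices outside `X ∪ D` to their dominators in `D`: the branch set of a
vertex `w`. -/
def dominatorStar (X D : Finset V) (dom : V → V) (w : V) : Set V :=
  {x | x = w ∨ (x ∉ X ∧ x ∉ D ∧ w ∈ D ∧ dom x = w)}

/-- The vertex of the contracted graph that stands for `u`. -/
noncomputable def starCentre (X D : Finset V) (dom : V → V) (u : V) : V :=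
  if u ∈ X ∪ D then u else dom u

/-- The neighbours of `x` in the contracted graph. -/
noncomputable def starNbhd (G : SimpleGraph V) (X D : Finset V) (dom : V → V) (x : V) : Finset V :=
  (X ∪ D).filter fun w => BranchAdj G (dominatorStar X D dom) x w

section Star

variable {G : SimpleGraph V} {X D : Finset V} {dom : V → V}

theorem isStarSystem_dominatorStar (hdom : ∀ u, u ∉ D → dom u ∈ D ∧ G.Adj (dom u) u) :
    IsStarSystem G (X ∪ D) (dominatorStar X D dom) := by
  refine ⟨fun w _ => Or.inl rfl, ?_, ?_⟩
  · rintro w - x (rfl | ⟨-, hx, -, rfl⟩)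
    · exact Or.inl rfl
    · exact Or.inr (hdom x hx).2
  · intro u hu w hw hne
    rw [Set.disjoint_left]
    rintro x (rfl | ⟨hx1, hx2, -, rfl⟩) (h | ⟨h1, h2, -, h3⟩)
    · exact hne h
    · rw [Finset.mem_union] at hu; tauto
    · subst h; rw [Finset.mem_union] at hw; tauto
    · exact hne h3

theorem starCentre_mem (hdom : ∀ u, u ∉ D → dom u ∈ D ∧ G.Adj (dom u) u) {x u : V}
    (hx : x ∈ X) (hxD : x ∉ D) (hxu : G.Adj x u) :
    starCentre X D dom u ∈ starNbhd G X D dom x := by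
  unfold starCentre starNbhd
  split_ifs with hu
  · exact Finset.mem_filter.mpr ⟨hu, hxu.ne, x, Or.inl rfl, u, Or.inl rfl, hxu⟩
  · have hu' : u ∉ X ∧ u ∉ D := by simpa using hu
    have hd := (hdom u hu'.2).1
    refine Finset.mem_filter.mpr ⟨Finset.mem_union_right _ hd, ?_, x, Or.inl rfl, u,
      Or.inr ⟨hu'.1, hu'.2, hd, rfl⟩, hxu⟩
    -- If x were the dominator of u, the edge xu would vanish in the contraction; `hxD` excludes
    -- this.
    rintro rfl
    exact hxD hd

/-- If all vertices of `X` have at least `m` neighbours in the contracted graph, then `X` is small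
compared with the dominating set `D`. -/
theorem mul_card_le_of_le_card_starNbhd [Fintype V] {k m : ℕ} (hG : nablaOne G ≤ (k : ℝ))
    (hdom : ∀ u, u ∉ D → dom u ∈ D ∧ G.Adj (dom u) u) (hXD : Disjoint X D)
    (hm : ∀ x ∈ X, m ≤ (starNbhd G X D dom x).card) :
    m * X.card ≤ k * (2 * X.card + D.card) := by
  -- Pairs are counted between X and X ∪ D, so X contributes to both sizes: this is the 2|X| in the
  -- bound.
  have h1 := (isStarSystem_dominatorStar (X := X) hdom).pairCount_le hG
    (Finset.subset_union_left (s₁ := X) (s₂ := D)) (subset_refl _)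
  rw [pairCount_eq_sum_left, Finset.card_union_of_disjoint hXD] at h1
  calc m * X.card = ∑ x ∈ X, m := by simp [mul_comm]
    _ ≤ _ := Finset.sum_le_sum hm
    _ ≤ _ := h1
    _ = _ := by ring

end Star

end Counting

/-! ### Hard and crowded vertices -/

section Phases

open scoped Classical

variable {V : Type*} [Fintype V]

/-- The closed neighbourhood of a vertex. -/
noncomputable def closedNbhd (G : SimpleGraph V) (v : V) : Finset V :=
  Finset.univ.filter fun u => u = v ∨ G.Adj v u

theorem mem_closedNbhd {G : SimpleGraph V} {u v : V} :
    u ∈ closedNbhd G v ↔ u = v ∨ G.Adj v u := by simp [closedNbhd]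

theorem self_mem_closedNbhd (G : SimpleGraph V) (v : V) : v ∈ closedNbhd G v :=
  mem_closedNbhd.mpr (Or.inl rfl)

theorem mem_closedNbhd_comm {G : SimpleGraph V} {u v : V} :
    u ∈ closedNbhd G v ↔ v ∈ closedNbhd G u := by
  rw [mem_closedNbhd, mem_closedNbhd, G.adj_comm, eq_comm]

/-- `A` is a set of vertices near `v`, other than `v`, that dominates the neighbours of `v`. -/
def CoversNbhd (G : SimpleGraph V) (v : V) (A : Finset V) : Prop :=
  A ⊆ (closedNbhd G v).biUnion (closedNbhd G) ∧ v ∉ A ∧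
    ∀ u, G.Adj v u → ∃ a ∈ A, u ∈ closedNbhd G a

/-- The vertices whose neighbourhood cannot be dominated by `2 * k` other vertices. -/
noncomputable def hardSet (G : SimpleGraph V) (k : ℕ) : Finset V :=
  Finset.univ.filter fun v => ¬ ∃ A, CoversNbhd G v A ∧ A.card ≤ 2 * k

/-- The vertices that `S` does not dominate. -/
noncomputable def undominated (G : SimpleGraph V) (S : Finset V) : Finset V :=
  Finset.univ.filter fun v => ¬ ∃ u ∈ closedNbhd G v, u ∈ S

theorem mem_undominated {G : SimpleGraph V} {S : Finset V} {v : V} :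
    v ∈ undominated G S ↔ ∀ u ∈ closedNbhd G v, u ∉ S := by simp [undominated]

theorem isDominating_iff {G : SimpleGraph V} {D : Finset V} :
    IsDominating G D ↔ ∀ v, ∃ u ∈ closedNbhd G v, u ∈ D := by
  refine forall_congr' fun v => ?_
  simp only [mem_closedNbhd]
  constructor
  · rintro (h | ⟨u, hu, huv⟩)
    · exact ⟨v, Or.inl rfl, h⟩
    · exact ⟨u, Or.inr huv.symm, hu⟩
  · rintro ⟨u, rfl | h, hu⟩
    · exact Or.inl hu
    · exact Or.inr ⟨u, hu, h.symm⟩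

/-- The vertices with more than `L` vertices of `R` in their closed neighbourhood. -/
noncomputable def crowdedSet (G : SimpleGraph V) (R : Finset V) (L : ℕ) : Finset V :=
  Finset.univ.filter fun v => L < ∑ u ∈ closedNbhd G v, if u ∈ R then 1 else 0

/-- With contracted degrees at least 2k + 1, the term 2k|X| cancels from the counting bound. -/
theorem card_hardSet_sdiff_le {G : SimpleGraph V} {k : ℕ} (hG : nablaOne G ≤ (k : ℝ))
    {D : Finset V} (hD : IsDominating G D) : (hardSet G k \ D).card ≤ k * D.card := by
  obtain ⟨dom, hdom⟩ := hD.exists_dom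
  have key := mul_card_le_of_le_card_starNbhd (X := hardSet G k \ D) (m := 2 * k + 1) hG hdom
    Finset.sdiff_disjoint ?_
  · nlinarith
  · intro x hx
    obtain ⟨hx1, hx2⟩ := Finset.mem_sdiff.mp hx
    by_contra hlt
    -- The contracted neighbours of x lie within distance two, omit x and dominate its neighbours;
    -- at most 2k of them would contradict hardness.
    refine (Finset.mem_filter.mp hx1).2 ⟨starNbhd G (hardSet G k \ D) D dom x, ⟨?_, ?_, ?_⟩,
      by omega⟩
    · intro w hw
      obtain ⟨-, -, a, ha, b, hb, hab⟩ := Finset.mem_filter.mp hw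
      have ha' : a = x := by
        rcases ha with h | h
        · exact h
        · exact absurd h.2.2.1 hx2
      subst ha'
      refine Finset.mem_biUnion.mpr ⟨b, mem_closedNbhd.mpr (Or.inr hab), ?_⟩
      rw [mem_closedNbhd_comm, mem_closedNbhd]
      rcases hb with h | ⟨-, h1, -, h2⟩
      · exact Or.inl h
      · exact Or.inr (h2 ▸ (hdom b h1).2)
    · intro h
      exact (Finset.mem_filter.mp h).2.1 rfl
    · intro u hu
      refine ⟨_, starCentre_mem hdom hx hx2 hu, ?_⟩
      unfold starCentre
      split_ifs with h
      · exact self_mem_closedNbhd G u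
      · rw [Finset.mem_union, not_or] at h
        exact mem_closedNbhd.mpr (Or.inr (hdom u h.2).2)

/-- The common neighbours of `u` and `w` in `R`. -/
noncomputable def commonNbhd (G : SimpleGraph V) (R : Finset V) (u w : V) : Finset V :=
  R.filter fun x => G.Adj u x ∧ G.Adj w x

theorem card_common_lt_of_free {G : SimpleGraph V} {t : ℕ}
    (hfree : (completeBipartiteGraph (Fin 3) (Fin t)).Free G) {a b c : V} (hab : a ≠ b)
    (hac : a ≠ c) (hbc : b ≠ c) :
    (Finset.univ.filter fun x => G.Adj a x ∧ G.Adj b x ∧ G.Adj c x).card < t := by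
  by_contra! h
  obtain ⟨S, hS, hcard⟩ := Finset.exists_subset_card_eq h
  let e := (S.equivFinOfCardEq hcard).symm
  have hadj : ∀ i, G.Adj a (e i) ∧ G.Adj b (e i) ∧ G.Adj c (e i) := fun i =>
    (Finset.mem_filter.mp (hS (e i).2)).2
  have hadj' : ∀ (i : Fin 3) j, G.Adj (![a, b, c] i) (e j) := by
    intro i j
    obtain ⟨h1, h2, h3⟩ := hadj j
    fin_cases i <;> assumption
  have hinj : Function.Injective ![a, b, c] := by
    intro i j hij
    fin_cases i <;> fin_cases j <;> simp_all
  refine hfree ⟨⟨⟨Sum.elim ![a, b, c] fun j => (e j : V), ?_⟩, ?_⟩⟩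
  · rintro (i | i) (j | j) hij
    · simp at hij
    · exact hadj' i j
    · exact (hadj' j i).symm
    · simp at hij
  · rintro (i | i) (j | j) hij
    · exact congrArg Sum.inl (hinj hij)
    · exact absurd hij (hadj' i j).ne
    · exact absurd hij.symm (hadj' j i).ne
    · exact congrArg Sum.inr (e.injective (Subtype.ext hij))

/-- The vertices other than `d` that share many neighbours in `R` with `d`. -/
noncomputable def twinSet (G : SimpleGraph V) (R : Finset V) (m : ℕ) (d : V) : Finset V :=
  Finset.univ.filter fun z => z ≠ d ∧ m < (commonNbhd G R z d).card

/-- If d is not hard, all its twins lie in a cover A of its neighbourhood. For z outside A, a common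
neighbour of z and d is either some a in A or adjacent to a, z and d; each a accounts for at most 1
+ (t - 1) of these. -/
theorem card_twinSet_le {G : SimpleGraph V} {k t : ℕ}
    (hfree : (completeBipartiteGraph (Fin 3) (Fin t)).Free G) (d : V) :
    (twinSet G (undominated G (hardSet G k)) (2 * k * t) d).card ≤ 2 * k := by
  by_cases hd : d ∈ hardSet G k
  -- A hard d already dominates its neighbours, so none of them remains in the residual set.
  · have : twinSet G (undominated G (hardSet G k)) (2 * k * t) d = ∅ := by
      refine Finset.filter_false_of_mem fun z _ hz => ?_
      obtain ⟨x, hx⟩ := Finset.card_pos.mp (Nat.zero_lt_of_lt hz.2)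
      obtain ⟨hx1, -, hx2⟩ := Finset.mem_filter.mp hx
      exact mem_undominated.mp hx1 d (mem_closedNbhd.mpr (Or.inr hx2.symm)) hd
    simp [this]
  · obtain ⟨A, ⟨-, hdA, hA⟩, hcard⟩ : ∃ A, CoversNbhd G d A ∧ A.card ≤ 2 * k := by
      by_contra h
      exact hd (Finset.mem_filter.mpr ⟨Finset.mem_univ _, h⟩)
    refine (Finset.card_le_card fun z hz => ?_).trans hcard
    obtain ⟨-, hzd, hz⟩ := Finset.mem_filter.mp hz
    by_contra hzA
    refine absurd hz (not_lt.mpr ?_)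
    have hsub : commonNbhd G (undominated G (hardSet G k)) z d ⊆
        A.biUnion fun a => insert a
          (Finset.univ.filter fun x => G.Adj a x ∧ G.Adj z x ∧ G.Adj d x) := by
      intro x hx
      obtain ⟨-, hx1, hx2⟩ := Finset.mem_filter.mp hx
      obtain ⟨a, ha, hax⟩ := hA x hx2
      refine Finset.mem_biUnion.mpr ⟨a, ha, ?_⟩
      rcases mem_closedNbhd.mp hax with h | h
      · exact Finset.mem_insert.mpr (Or.inl h)
      · exact Finset.mem_insert_of_mem (by simp [h, hx1, hx2])
    refine (Finset.card_le_card hsub).trans ((Finset.card_biUnion_le_card_mul _ _ t ?_).trans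
      (Nat.mul_le_mul_right _ hcard))
    intro a ha
    exact (Finset.card_insert_le _ _).trans (card_common_lt_of_free hfree
      (fun h => hzA (h ▸ ha)) (fun h => hdA (h ▸ ha)) hzd)

/-- Crowded vertices that share few neighbours with every vertex of the dominating set `D` are
rare. -/
theorem card_le_of_crowded {G : SimpleGraph V} {k m : ℕ} (hk : 0 < k)
    (hG : nablaOne G ≤ (k : ℝ)) {D : Finset V} (hD : IsDominating G D) {R X : Finset V}
    (hXD : Disjoint X D) (hX : X ⊆ crowdedSet G R (3 * k * (m + 1)))
    (hfew : ∀ x ∈ X, ∀ d ∈ D, (commonNbhd G R x d).card ≤ m) : X.card ≤ D.card := by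
  obtain ⟨dom, hdom⟩ := hD.exists_dom
  have key := mul_card_le_of_le_card_starNbhd (X := X) (m := 3 * k) hG hdom hXD ?_
  · have : k * X.card ≤ k * D.card := by nlinarith
    exact Nat.le_of_mul_le_mul_left this hk
  · intro x hx
    have hxD := Finset.disjoint_left.mp hXD hx
    set Q := R.filter fun u => G.Adj x u with hQ
    -- The strict inequality in `crowdedSet` pays for x itself, which may belong to R.
    have h1 : 3 * k * (m + 1) ≤ Q.card := by
      have h2 := (Finset.mem_filter.mp (hX hx)).2
      rw [← Finset.card_filter] at h2
      have h3 : (closedNbhd G x).filter (· ∈ R) ⊆ insert x Q := by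
        intro u hu
        obtain ⟨hu1, hu2⟩ := Finset.mem_filter.mp hu
        rcases mem_closedNbhd.mp hu1 with h | h
        · exact Finset.mem_insert.mpr (Or.inl h)
        · exact Finset.mem_insert_of_mem (Finset.mem_filter.mpr ⟨hu2, h⟩)
      have := (Finset.card_le_card h3).trans (Finset.card_insert_le _ _)
      omega
    -- Each contracted neighbour w absorbs at most m + 1 vertices of Q: w itself and, if w is in D,
    -- its common neighbours with x.
    have h2 : Q.card ≤ (m + 1) * (starNbhd G X D dom x).card := by
      refine Finset.card_le_mul_card_image_of_maps_to (f := starCentre X D dom)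
        (fun u hu => starCentre_mem hdom hx hxD (Finset.mem_filter.mp hu).2) _ fun w hw => ?_
      by_cases hwD : w ∈ D
      · have : (Q.filter fun u => starCentre X D dom u = w) ⊆
            insert w (commonNbhd G R x w) := by
          intro u hu
          obtain ⟨hu1, hu2⟩ := Finset.mem_filter.mp hu
          obtain ⟨hu3, hu4⟩ := Finset.mem_filter.mp hu1
          unfold starCentre at hu2
          split_ifs at hu2 with h
          · exact Finset.mem_insert.mpr (Or.inl hu2)
          · rw [Finset.mem_union, not_or] at h
            exact Finset.mem_insert_of_mem
              (Finset.mem_filter.mpr ⟨hu3, hu4, hu2 ▸ (hdom u h.2).2⟩)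
        refine (Finset.card_le_card this).trans ((Finset.card_insert_le _ _).trans ?_)
        exact Nat.succ_le_succ (hfew x hx w hwD)
      · have : (Q.filter fun u => starCentre X D dom u = w) ⊆ {w} := by
          intro u hu
          have hu2 := (Finset.mem_filter.mp hu).2
          unfold starCentre at hu2
          split_ifs at hu2 with h
          · exact Finset.mem_singleton.mpr hu2
          · rw [Finset.mem_union, not_or] at h
            exact absurd (hu2 ▸ (hdom u h.2).1) hwD
        refine (Finset.card_le_card this).trans ?_
        simp
    have h3 : (m + 1) * (3 * k) ≤ (m + 1) * (starNbhd G X D dom x).card := by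
      rw [mul_comm]; exact h1.trans h2
    exact Nat.le_of_mul_le_mul_left h3 (Nat.succ_pos m)

/-- A bound on the number of vertices that remain to be dominated in any neighbourhood, once the
hard and the crowded vertices have been selected. -/
def residualBound (k t : ℕ) : ℕ := 3 * k * (2 * k * t + 1)

theorem residualBound_pos {k : ℕ} (hk : 0 < k) (t : ℕ) : 0 < residualBound k t := by
  unfold residualBound; positivity

/-- The hard vertices together with the vertices that are crowded afterwards. -/
noncomputable def preselected (G : SimpleGraph V) (k t : ℕ) : Finset V :=
  hardSet G k ∪ crowdedSet G (undominated G (hardSet G k)) (residualBound k t)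

/-- Four sets cover the selection: D, the hard vertices outside D, the twins of D, and the remaining
crowded vertices. Their sizes are at most 1, k, 2k and 1 times |D|. -/
theorem card_preselected_le {G : SimpleGraph V} {k t : ℕ} (hk : 0 < k)
    (hG : nablaOne G ≤ (k : ℝ)) (hfree : (completeBipartiteGraph (Fin 3) (Fin t)).Free G)
    {D : Finset V} (hD : IsDominating G D) :
    (preselected G k t).card ≤ (3 * k + 2) * D.card := by
  set R := undominated G (hardSet G k)
  set X := crowdedSet G R (residualBound k t) \ (D ∪ D.biUnion (twinSet G R (2 * k * t))) with hX
  have hX1 : X.card ≤ D.card := by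
    refine card_le_of_crowded (m := 2 * k * t) (R := R) hk hG hD ?_ Finset.sdiff_subset ?_
    · rw [Finset.disjoint_left]
      intro x hx hxD
      exact (Finset.mem_sdiff.mp hx).2 (Finset.mem_union_left _ hxD)
    · intro x hx d hd
      by_contra! h
      refine (Finset.mem_sdiff.mp hx).2 ?_
      by_cases hxd : x = d
      · exact Finset.mem_union_left _ (hxd ▸ hd)
      · exact Finset.mem_union_right _ (Finset.mem_biUnion.mpr
          ⟨d, hd, Finset.mem_filter.mpr ⟨Finset.mem_univ _, hxd, h⟩⟩)
  have h2 : (D.biUnion (twinSet G R (2 * k * t))).card ≤ D.card * (2 * k) :=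
    Finset.card_biUnion_le_card_mul _ _ _ fun d _ => card_twinSet_le hfree d
  have h3 := card_hardSet_sdiff_le hG hD
  have hsub : preselected G k t ⊆
      D ∪ (hardSet G k \ D) ∪ D.biUnion (twinSet G R (2 * k * t)) ∪ X := by
    intro v hv
    rw [preselected, Finset.mem_union] at hv
    simp only [hX, Finset.mem_union, Finset.mem_sdiff]
    tauto
  have h4 := Finset.card_le_card hsub
  have h5 := Finset.card_union_le (D ∪ (hardSet G k \ D) ∪ D.biUnion (twinSet G R (2 * k * t))) X
  have h6 := Finset.card_union_le (D ∪ (hardSet G k \ D)) (D.biUnion (twinSet G R (2 * k * t)))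
  have h7 := Finset.card_union_le D (hardSet G k \ D)
  nlinarith

theorem sum_undominated_preselected_le (G : SimpleGraph V) (k t : ℕ) (v : V) :
    ∑ u ∈ closedNbhd G v, (if u ∈ undominated G (preselected G k t) then 1 else 0) ≤
      residualBound k t := by
  by_cases hv : v ∈ crowdedSet G (undominated G (hardSet G k)) (residualBound k t)
  · rw [Finset.sum_eq_zero]
    · exact Nat.zero_le _
    · intro u hu
      rw [if_neg]
      intro h
      exact mem_undominated.mp h v (mem_closedNbhd_comm.mp hu) (Finset.mem_union_right _ hv)
  · have h : ∑ u ∈ closedNbhd G v, (if u ∈ undominated G (hardSet G k) then 1 else 0) ≤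
        residualBound k t := by simpa [crowdedSet] using hv
    refine le_trans (Finset.sum_le_sum fun u _ => ?_) h
    by_cases hu : u ∈ undominated G (preselected G k t)
    · have : u ∈ undominated G (hardSet G k) :=
        mem_undominated.mpr fun w hw h' =>
          mem_undominated.mp hu w hw (Finset.mem_union_left _ h')
      rw [if_pos hu, if_pos this]
    · rw [if_neg hu]; exact Nat.zero_le _

/-! ### The primal-dual phase -/

/-- The dual variables of the primal-dual phase for dominating `R`: in every round, the variable of
a vertex of `R` grows by one unless it occurs in a constraint that has reached the threshold `θ`. -/
noncomputable def dual (G : SimpleGraph V) (R : Finset V) (θ : ℕ) : ℕ → V → ℕ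
  | 0, _ => 0
  | n + 1, u => dual G R θ n u +
      if u ∈ R ∧ ¬ ∃ v ∈ closedNbhd G u, θ ≤ ∑ w ∈ closedNbhd G v, dual G R θ n w then 1 else 0

/-- The vertices whose constraint has reached the threshold after `n` rounds. -/
noncomputable def tightSet (G : SimpleGraph V) (R : Finset V) (θ n : ℕ) : Finset V :=
  Finset.univ.filter fun v => θ ≤ ∑ w ∈ closedNbhd G v, dual G R θ n w

theorem mem_tightSet {G : SimpleGraph V} {R : Finset V} {θ n : ℕ} {v : V} :
    v ∈ tightSet G R θ n ↔ θ ≤ ∑ w ∈ closedNbhd G v, dual G R θ n w := by simp [tightSet]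

/-- The vertices selected by the primal-dual phase. -/
noncomputable def coverSet (G : SimpleGraph V) (R : Finset V) (θ n : ℕ) : Finset V :=
  tightSet G R θ n ∪ (R ∩ undominated G (tightSet G R θ n))

section Dual

variable (G : SimpleGraph V) (R : Finset V) (θ : ℕ)

theorem dual_le_succ (n : ℕ) (u : V) : dual G R θ n u ≤ dual G R θ (n + 1) u := by
  rw [dual]; exact Nat.le_add_right _ _

theorem dual_le (n : ℕ) (u : V) : dual G R θ n u ≤ n := by
  induction n with
  | zero => exact le_rfl
  | succ n ih => rw [dual]; split_ifs <;> omega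

theorem dual_eq_zero (n : ℕ) {u : V} (hu : u ∉ R) : dual G R θ n u = 0 := by
  induction n with
  | zero => rfl
  | succ n ih => rw [dual, ih, if_neg fun h => hu h.1]

theorem tightSet_subset_succ (n : ℕ) : tightSet G R θ n ⊆ tightSet G R θ (n + 1) := fun _ hv =>
  mem_tightSet.mpr ((mem_tightSet.mp hv).trans
    (Finset.sum_le_sum fun w _ => dual_le_succ G R θ n w))

/-- Tight sets only grow, so such a vertex was never frozen and gained one unit in every round. -/
theorem dual_eq_of_undominated (n : ℕ) {u : V} (hu : u ∈ R)
    (h : u ∈ undominated G (tightSet G R θ n)) : dual G R θ n u = n := by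
  induction n with
  | zero => rfl
  | succ n ih =>
    have h' : u ∈ undominated G (tightSet G R θ n) := mem_undominated.mpr fun v hv hv' =>
      mem_undominated.mp h v hv (tightSet_subset_succ G R θ n hv')
    rw [dual, ih h', if_pos]
    refine ⟨hu, ?_⟩
    rintro ⟨v, hv, hv'⟩
    exact mem_undominated.mp h' v hv (mem_tightSet.mpr hv')

/-- A constraint freezes its variables on reaching θ, and the last round before that adds at most Δ.
-/
theorem sum_dual_le {Δ : ℕ}
    (hΔ : ∀ v, ∑ u ∈ closedNbhd G v, (if u ∈ R then 1 else 0) ≤ Δ) (n : ℕ) (v : V) :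
    ∑ u ∈ closedNbhd G v, dual G R θ n u ≤ θ + Δ := by
  induction n with
  | zero => simp [dual]
  | succ n ih =>
    by_cases hv : θ ≤ ∑ u ∈ closedNbhd G v, dual G R θ n u
    · refine le_of_eq_of_le (Finset.sum_congr rfl fun u hu => ?_) ih
      rw [dual, if_neg, add_zero]
      exact fun h => h.2 ⟨v, mem_closedNbhd_comm.mp hu, hv⟩
    · simp only [dual, Finset.sum_add_distrib]
      refine add_le_add (not_le.mp hv).le (le_trans (Finset.sum_le_sum fun u _ => ?_) (hΔ v))
      split_ifs <;> first | omega | tauto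

/-- Vertices of R undominated by T have full dual value n and pay for themselves. The other dual
variables pay for T, since by sparsity the constraints of T cannot overlap too heavily. -/
theorem mul_card_coverSet_le {k L : ℕ} (hG : nablaOne G ≤ (k : ℝ)) :
    3 * L * (coverSet G R (3 * ((2 * k + 1) * L)) (3 * L)).card ≤
      ∑ u ∈ R, dual G R (3 * ((2 * k + 1) * L)) (3 * L) u := by
  set θ := 3 * ((2 * k + 1) * L) with hθ
  set n := 3 * L with hn
  set T := tightSet G R θ n with hT
  set y := dual G R θ n with hy
  set U := R \ undominated G T with hU
  have hsplit : ∑ u ∈ R, y u = ∑ u ∈ U, y u + ∑ u ∈ R ∩ undominated G T, y u := by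
    rw [← Finset.sum_sdiff (s₁ := R ∩ undominated G T) (s₂ := R) Finset.inter_subset_left,
      Finset.sdiff_inter_self_left]
  have hcap : ∑ u ∈ R ∩ undominated G T, y u = n * (R ∩ undominated G T).card := by
    rw [Finset.sum_congr rfl fun u hu => dual_eq_of_undominated G R θ n
      (Finset.mem_inter.mp hu).1 (Finset.mem_inter.mp hu).2, Finset.sum_const, smul_eq_mul, mul_comm]
  have hw := sum_weight_le (fun _ _ h => G.adj_symm h) (pairCount_adj_self_le hG) T U y n
    (dual_le G R θ n)
  -- Variables in a tight constraint vanish outside R, and vertices of R there are dominated by T;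
  -- only U contributes.
  have hlow : ∀ v ∈ T, θ ≤ ∑ u ∈ U.filter (fun u => G.Adj v u), y u + if v ∈ U then y v else 0 := by
    intro v hv
    refine (mem_tightSet.mp hv).trans ?_
    have h1 : ∑ w ∈ closedNbhd G v, y w = y v + ∑ w ∈ Finset.univ.filter (G.Adj v), y w := by
      have h0 : closedNbhd G v = insert v (Finset.univ.filter (G.Adj v)) := by
        ext w
        simp [mem_closedNbhd]
      rw [h0, Finset.sum_insert (by simp)]
    have h2 : ∀ w, w ∈ closedNbhd G v → w ∉ U → y w = 0 := by
      intro w hw hwU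
      refine dual_eq_zero G R θ n fun hwR => hwU (Finset.mem_sdiff.mpr ⟨hwR, fun h => ?_⟩)
      exact mem_undominated.mp h v (mem_closedNbhd_comm.mp hw) hv
    have h3 : ∑ w ∈ Finset.univ.filter (G.Adj v), y w = ∑ u ∈ U.filter (fun u => G.Adj v u), y u := by
      symm
      refine Finset.sum_subset (Finset.filter_subset_filter _ (Finset.subset_univ _)) ?_
      intro w hw hw'
      have hadj := (Finset.mem_filter.mp hw).2
      exact h2 w (mem_closedNbhd.mpr (Or.inr hadj)) fun h => hw' (Finset.mem_filter.mpr ⟨h, hadj⟩)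
    have h4 : y v = if v ∈ U then y v else 0 := by
      split_ifs with h
      · rfl
      · exact h2 v (self_mem_closedNbhd G v) h
    rw [← hy, h1, h3, ← h4, add_comm]
  have hsum := Finset.sum_le_sum hlow
  have hself : ∑ v ∈ T, (if v ∈ U then y v else 0) ≤ ∑ u ∈ U, y u := by
    rw [← Finset.sum_filter]
    exact Finset.sum_le_sum_of_subset fun v hv => (Finset.mem_filter.mp hv).2
  rw [Finset.sum_const, smul_eq_mul, Finset.sum_add_distrib] at hsum
  -- The choice θ = (2k + 1)n leaves (k + 1)n per tight vertex after the sparsity loss nk, matching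
  -- the k + 1 copies of the dual sum.
  have htight : n * T.card ≤ ∑ u ∈ U, y u := by
    have h1 : (k + 1) * (n * T.card) ≤ (k + 1) * ∑ u ∈ U, y u := by
      have : T.card * θ = n * k * T.card + (k + 1) * (n * T.card) := by
        rw [hθ, hn]; ring
      linarith
    exact Nat.le_of_mul_le_mul_left h1 (Nat.succ_pos k)
  have hcard := Finset.card_union_le T (R ∩ undominated G T)
  calc n * (coverSet G R θ n).card ≤ n * (T.card + (R ∩ undominated G T).card) :=
        Nat.mul_le_mul_left _ hcard
    _ ≤ _ := by rw [mul_add, hsplit, hcap]; exact Nat.add_le_add_right htight _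

/-- Weak duality: each variable occurs in the constraint of some vertex of D. -/
theorem sum_dual_le_mul_card {Δ n : ℕ}
    (hΔ : ∀ v, ∑ u ∈ closedNbhd G v, (if u ∈ R then 1 else 0) ≤ Δ) {D : Finset V}
    (hD : IsDominating G D) : ∑ u ∈ R, dual G R θ n u ≤ (θ + Δ) * D.card := by
  rw [isDominating_iff] at hD
  calc ∑ u ∈ R, dual G R θ n u
      ≤ ∑ u ∈ R, ∑ d ∈ D, if u ∈ closedNbhd G d then dual G R θ n u else 0 := by
        refine Finset.sum_le_sum fun u _ => ?_
        obtain ⟨d, hd, hdD⟩ := hD u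
        refine le_trans ?_ (Finset.single_le_sum (fun _ _ => Nat.zero_le _) hdD)
        rw [if_pos (mem_closedNbhd_comm.mp hd)]
    _ ≤ ∑ u, ∑ d ∈ D, if u ∈ closedNbhd G d then dual G R θ n u else 0 :=
        Finset.sum_le_sum_of_subset (Finset.subset_univ R)
    _ = ∑ d ∈ D, ∑ u ∈ closedNbhd G d, dual G R θ n u := by
        rw [Finset.sum_comm]
        simp
    _ ≤ ∑ d ∈ D, (θ + Δ) := Finset.sum_le_sum fun d _ => sum_dual_le G R θ hΔ n d
    _ = _ := by simp [mul_comm]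

end Dual

/-! ### The whole selection -/

/-- The dominating set computed by the algorithm. -/
noncomputable def selected (G : SimpleGraph V) (k t : ℕ) : Finset V :=
  preselected G k t ∪ coverSet G (undominated G (preselected G k t))
    (3 * ((2 * k + 1) * residualBound k t)) (3 * residualBound k t)

theorem isDominating_selected (G : SimpleGraph V) (k t : ℕ) :
    IsDominating G (selected G k t) := by
  rw [isDominating_iff]
  intro v
  by_contra! h
  have h1 : v ∈ undominated G (preselected G k t) := mem_undominated.mpr fun u hu hu' =>
    h u hu (Finset.mem_union_left _ hu')
  refine h v (self_mem_closedNbhd G v) (Finset.mem_union_right _ (Finset.mem_union_right _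
    (Finset.mem_inter.mpr ⟨h1, mem_undominated.mpr fun u hu hu' => ?_⟩)))
  exact h u hu (Finset.mem_union_right _ (Finset.mem_union_left _ hu'))

theorem card_selected_le {G : SimpleGraph V} {k t : ℕ} (hk : 0 < k)
    (hG : nablaOne G ≤ (k : ℝ)) (hfree : (completeBipartiteGraph (Fin 3) (Fin t)).Free G) :
    (selected G k t).card ≤ (6 * k + 3) * domNumber G := by
  obtain ⟨D, hD, hcard⟩ := exists_isDominating_card_eq G
  rw [← hcard]
  set L := residualBound k t with hL
  have hpos : 0 < L := residualBound_pos hk t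
  set R := undominated G (preselected G k t)
  set θ := 3 * ((2 * k + 1) * L) with hθ
  have h1 := card_preselected_le hk hG hfree hD
  have h2 := mul_card_coverSet_le (L := L) G R hG
  -- The residual bound L is relaxed to (2k + 1)L, making θ + Δ equal to 4(2k + 1)L. The resulting
  -- total 3k + 2 + 4(2k + 1)/3 is at most 6k + 3 because k ≥ 1.
  have h3 := sum_dual_le_mul_card G R θ (Δ := (2 * k + 1) * L) (n := 3 * L)
    (fun v => (sum_undominated_preselected_le G k t v).trans
      (Nat.le_mul_of_pos_left _ (Nat.succ_pos _))) hD
  have h4 : 3 * (coverSet G R θ (3 * L)).card ≤ 4 * (2 * k + 1) * D.card := by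
    refine le_of_mul_le_mul_left ?_ hpos
    calc L * (3 * (coverSet G R θ (3 * L)).card) = 3 * L * (coverSet G R θ (3 * L)).card := by ring
      _ ≤ (θ + (2 * k + 1) * L) * D.card := h2.trans h3
      _ = _ := by rw [hθ]; ring
  have h5 : (selected G k t).card ≤ (preselected G k t).card + (coverSet G R θ (3 * L)).card :=
    Finset.card_union_le _ _
  nlinarith [Nat.mul_le_mul_right D.card hk]

end Phases

/-! ### Locality and simulation by views -/

section Locality

open scoped Classical

universe u

/-- A finite graph with pairwise distinct identifiers. -/
structure Network where
  /-- nodes -/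
  V : Type u
  [fintype : Fintype V]
  /-- links -/
  G : SimpleGraph V
  /-- identifiers -/
  ident : V → ℕ
  ident_injective : Function.Injective ident

attribute [instance] Network.fintype

/-- What a node can learn within `n` rounds. -/
def View : ℕ → Type
  | 0 => ℕ
  | n + 1 => View n × Set (View n)

/-- The view of a node after `n` rounds. -/
def view {V : Type u} (G : SimpleGraph V) (ident : V → ℕ) : (n : ℕ) → V → View n
  | 0, v => ident v
  | n + 1, v => (view G ident n v, view G ident n '' {u | G.Adj v u})

/-- `f` is determined by the views after `n` rounds. -/
def IsLocalAt {α : Type*} (n : ℕ) (f : (N : Network.{u}) → N.V → α) : Prop :=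
  ∃ φ : View n → α, ∀ N v, f N v = φ (view N.G N.ident n v)

/-- `f` can be computed in a constant number of rounds. -/
def IsLocal {α : Type*} (f : (N : Network.{u}) → N.V → α) : Prop := ∃ n, IsLocalAt n f

variable {α β : Type*} {f : (N : Network.{u}) → N.V → α} {g : (N : Network.{u}) → N.V → β}

theorem IsLocalAt.succ {n : ℕ} (h : IsLocalAt n f) : IsLocalAt (n + 1) f := by
  obtain ⟨φ, hφ⟩ := h
  exact ⟨fun x => φ x.1, hφ⟩

theorem IsLocalAt.mono {m n : ℕ} (h : IsLocalAt m f) (hmn : m ≤ n) : IsLocalAt n f := by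
  induction hmn with
  | refl => exact h
  | step _ ih => exact ih.succ

theorem isLocal_const (a : α) : IsLocal.{u} fun _ _ => a := ⟨0, fun _ => a, fun _ _ => rfl⟩

theorem isLocal_ident : IsLocal.{u} fun N v => N.ident v := ⟨0, fun x => x, fun _ _ => rfl⟩

theorem IsLocal.comp (φ : α → β) (hf : IsLocal f) : IsLocal fun N v => φ (f N v) := by
  obtain ⟨n, ψ, hψ⟩ := hf
  exact ⟨n, fun x => φ (ψ x), fun N v => congrArg φ (hψ N v)⟩

theorem IsLocal.prodMk (hf : IsLocal f) (hg : IsLocal g) : IsLocal fun N v => (f N v, g N v) := by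
  obtain ⟨m, hm⟩ := hf
  obtain ⟨n, hn⟩ := hg
  obtain ⟨φ, hφ⟩ := hm.mono (le_max_left m n)
  obtain ⟨ψ, hψ⟩ := hn.mono (le_max_right m n)
  exact ⟨max m n, fun x => (φ x, ψ x), fun N v => Prod.ext (hφ N v) (hψ N v)⟩

theorem IsLocal.comp₂ {γ : Type*} (φ : α → β → γ) (hf : IsLocal f) (hg : IsLocal g) :
    IsLocal fun N v => φ (f N v) (g N v) :=
  (hf.prodMk hg).comp fun x => φ x.1 x.2

theorem IsLocal.image_nbhd (hf : IsLocal f) : IsLocal fun N v => f N '' {u | N.G.Adj v u} := by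
  obtain ⟨n, φ, hφ⟩ := hf
  refine ⟨n + 1, fun x => φ '' x.2, fun N v => ?_⟩
  change f N '' _ = φ '' (view N.G N.ident n '' _)
  rw [Set.image_image]
  exact Set.image_congr fun u _ => hφ N u

theorem IsLocal.image_closedNbhd (hf : IsLocal f) :
    IsLocal fun N v => f N '' (closedNbhd N.G v : Set N.V) := by
  convert hf.comp₂ (fun a S => insert a S) hf.image_nbhd using 3 with N v
  rw [← Set.image_insert_eq]
  congr 1
  ext u
  simp [mem_closedNbhd]

theorem IsLocal.not {P : (N : Network.{u}) → N.V → Prop} (hP : IsLocal P) :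
    IsLocal fun N v => ¬ P N v := hP.comp Not

theorem IsLocal.exists_closedNbhd {P : (N : Network.{u}) → N.V → Prop} (hP : IsLocal P) :
    IsLocal fun N v => ∃ u ∈ closedNbhd N.G v, P N u := by
  convert hP.image_closedNbhd.comp (fun S => True ∈ S) using 3 with N v
  simp

/-- Views hold sets without multiplicity; pairing values with distinct identifiers keeps equal
summands apart. -/
theorem IsLocal.sum_closedNbhd {y : (N : Network.{u}) → N.V → ℕ} (hy : IsLocal y) :
    IsLocal fun N v => ∑ u ∈ closedNbhd N.G v, y N u := by
  convert (isLocal_ident.prodMk hy).image_closedNbhd.comp (fun S => ∑ᶠ q ∈ S, q.2) using 3 with N v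
  rw [finsum_mem_image, finsum_mem_coe_finset]
  intro a _ b _ hab
  exact N.ident_injective (congrArg Prod.fst hab)

/-- Candidate covers lie within distance two, so a table of closed neighbourhoods in that ball,
written in identifiers, decides hardness. -/
theorem isLocal_hardSet (k : ℕ) : IsLocal.{u} fun N v => v ∈ hardSet N.G k := by
  have hrow : IsLocal.{u} fun N v => (N.ident v, N.ident '' (closedNbhd N.G v : Set N.V)) :=
    isLocal_ident.prodMk isLocal_ident.image_closedNbhd
  have htable := hrow.image_closedNbhd.image_closedNbhd.comp Set.sUnion
  have hnbr := isLocal_ident.{u}.prodMk isLocal_ident.image_nbhd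
  convert (htable.comp₂ (fun S (q : ℕ × Set ℕ) => ∃ A : Finset (ℕ × Set ℕ), ((A : Set _) ⊆ S ∧
    (∀ a ∈ A, a.1 ≠ q.1) ∧ ∀ x ∈ q.2, ∃ a ∈ A, x ∈ a.2) ∧ A.card ≤ 2 * k) hnbr).not using 3
    with N v
  set row : N.V → ℕ × Set ℕ := fun v => (N.ident v, N.ident '' (closedNbhd N.G v : Set N.V))
  have hinj : Function.Injective row := fun a b h => N.ident_injective (congrArg Prod.fst h)
  have htab : ⋃₀ ((fun u => row '' (closedNbhd N.G u : Set N.V)) '' (closedNbhd N.G v : Set N.V)) =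
      row '' ((closedNbhd N.G v).biUnion (closedNbhd N.G) : Set N.V) := by
    rw [Set.sUnion_image, Finset.coe_biUnion, Set.image_iUnion₂]
  have himg : ∀ A : Finset N.V, CoversNbhd N.G v A ↔
      ((A.image row : Set _) ⊆ row '' ((closedNbhd N.G v).biUnion (closedNbhd N.G) : Set N.V) ∧
        (∀ a ∈ A.image row, a.1 ≠ N.ident v) ∧
        ∀ x ∈ N.ident '' {u | N.G.Adj v u}, ∃ a ∈ A.image row, x ∈ a.2) := by
    intro A
    rw [CoversNbhd, Finset.coe_image, Set.image_subset_image_iff hinj, Finset.coe_subset]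
    refine and_congr Iff.rfl (and_congr ?_ ?_)
    · rw [Finset.forall_mem_image]
      refine ⟨fun h a ha hav => h (N.ident_injective hav ▸ ha), fun h hv => h hv rfl⟩
    · rw [Set.forall_mem_image]
      refine forall₂_congr fun u _ => ?_
      rw [Finset.exists_mem_image]
      refine exists_congr fun a => and_congr Iff.rfl ?_
      exact (N.ident_injective.mem_set_image (s := (closedNbhd N.G a : Set N.V))).symm
  simp only [hardSet, Finset.mem_filter, Finset.mem_univ, true_and]
  rw [htab]
  refine not_congr ⟨?_, ?_⟩
  · rintro ⟨A, hA, hcard⟩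
    exact ⟨A.image row, (himg A).mp hA, Finset.card_image_le.trans hcard⟩
  · rintro ⟨A, hA, hcard⟩
    obtain ⟨A', -, rfl⟩ := Finset.subset_set_image_iff.mp hA.1
    exact ⟨A', (himg A').mpr hA, by rwa [Finset.card_image_of_injective _ hinj] at hcard⟩

theorem isLocal_undominated {S : (N : Network.{u}) → Finset N.V}
    (hS : IsLocal fun N v => v ∈ S N) : IsLocal fun N v => v ∈ undominated N.G (S N) := by
  simpa [undominated] using hS.exists_closedNbhd.not

theorem isLocal_crowdedSet {R : (N : Network.{u}) → Finset N.V}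
    (hR : IsLocal fun N v => v ∈ R N) (L : ℕ) :
    IsLocal fun N v => v ∈ crowdedSet N.G (R N) L := by
  convert (hR.comp fun P => if P then 1 else 0).sum_closedNbhd.comp fun s => L < s using 3
  simp only [crowdedSet, Finset.mem_filter, Finset.mem_univ, true_and]
  congr!

theorem isLocal_dual {R : (N : Network.{u}) → Finset N.V}
    (hR : IsLocal fun N v => v ∈ R N) (θ n : ℕ) :
    IsLocal fun N v => dual N.G (R N) θ n v := by
  induction n with
  | zero => exact isLocal_const 0
  | succ n ih =>
    have h1 := (ih.sum_closedNbhd.comp fun s => θ ≤ s).exists_closedNbhd.not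
    convert ih.comp₂ (fun a b => a + b) ((hR.comp₂ And h1).comp fun P => if P then 1 else 0)
      using 3
    rw [dual]
    congr

theorem IsLocal.mem_union {S T : (N : Network.{u}) → Finset N.V}
    (hS : IsLocal fun N v => v ∈ S N) (hT : IsLocal fun N v => v ∈ T N) :
    IsLocal fun N v => v ∈ S N ∪ T N := by
  simpa using hS.comp₂ Or hT

theorem IsLocal.mem_inter {S T : (N : Network.{u}) → Finset N.V}
    (hS : IsLocal fun N v => v ∈ S N) (hT : IsLocal fun N v => v ∈ T N) :
    IsLocal fun N v => v ∈ S N ∩ T N := by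
  simpa using hS.comp₂ And hT

theorem isLocal_tightSet {R : (N : Network.{u}) → Finset N.V}
    (hR : IsLocal fun N v => v ∈ R N) (θ n : ℕ) :
    IsLocal fun N v => v ∈ tightSet N.G (R N) θ n := by
  simpa [tightSet] using (isLocal_dual hR θ n).sum_closedNbhd.comp fun s => θ ≤ s

theorem isLocal_selected (k t : ℕ) : IsLocal.{u} fun N v => v ∈ selected N.G k t := by
  have h1 := isLocal_hardSet.{u} k
  have h2 := h1.mem_union (isLocal_crowdedSet (isLocal_undominated h1) (residualBound k t))
  have h3 := isLocal_undominated h2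
  have h4 := isLocal_tightSet h3 (3 * ((2 * k + 1) * residualBound k t)) (3 * residualBound k t)
  exact h2.mem_union (h4.mem_union (h3.mem_inter (isLocal_undominated h4)))

/-- The algorithm that collects the view of every node after `r` rounds and then decides by `φ`. -/
noncomputable def viewAlgorithm (r : ℕ) (φ : View r → Prop) : LocalAlgorithm where
  State := Σ n, View n
  Msg := Σ n, View n
  init _ i := ⟨0, i⟩
  send _ s _ := s
  receive _ s m := if s.1 = r then s else
    ⟨s.1 + 1, s.2, {x | ∃ i, m i = ⟨s.1, x⟩}⟩
  output s := if h : s.1 = r then some (decide (φ (h ▸ s.2))) else none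
  receive_of_stopped := by
    intro _ s _ h
    by_cases hs : s.1 = r
    · exact if_pos hs
    · simp [hs] at h

/-- All nodes advance in lockstep, so every message carries the receiver's current stage and none is
discarded. -/
theorem viewAlgorithm_run (r : ℕ) (φ : View r → Prop) {V : Type u} (G : SimpleGraph V)
    [G.LocallyFinite] (p : PortNumbering G) (ident : V → ℕ) {n : ℕ} (hn : n ≤ r) (v : V) :
    (viewAlgorithm r φ).run G p ident n v = ⟨n, view G ident n v⟩ := by
  induction n generalizing v with
  | zero => rfl
  | succ n ih =>
    have ih' := ih (Nat.le_of_succ_le hn)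
    simp only [LocalAlgorithm.run]
    rw [ih' v]
    simp only [viewAlgorithm] at ih' ⊢
    rw [if_neg (by omega)]
    simp only [ih']
    congr 1
    rw [view]
    congr 1
    ext x
    constructor
    · rintro ⟨i, hi⟩
      exact ⟨(p v i).1, (p v i).2, eq_of_heq (Sigma.mk.inj hi).2⟩
    · rintro ⟨w, hw, rfl⟩
      exact ⟨(p v).symm ⟨w, hw⟩, by simp⟩

theorem viewAlgorithm_computesWithin {r : ℕ} {φ : View r → Prop} {V : Type u} (G : SimpleGraph V)
    [G.LocallyFinite] (p : PortNumbering G) (ident : V → ℕ) {D : Finset V}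
    (h : ∀ v, v ∈ D ↔ φ (view G ident r v)) :
    (viewAlgorithm r φ).ComputesWithin G p ident r D := by
  intro v
  rw [viewAlgorithm_run r φ G p ident le_rfl]
  exact ⟨decide (φ (view G ident r v)), by simp [viewAlgorithm], by simp [h]⟩

end Locality

end DistDom

theorem theorem2 (nabla t : ℕ) (hnabla : 0 < nabla) (ht : 3 ≤ t) :
    ∃ (A : DistDom.LocalAlgorithm) (C : ℝ → ℕ),
      ∀ (V : Type*) [Fintype V] (G : SimpleGraph V) [G.LocallyFinite],
        (completeBipartiteGraph (Fin 3) (Fin t)).Free G →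
        DistDom.nablaOne G ≤ (nabla : ℝ) →
        ∀ ε : ℝ, 0 < ε →
        ∀ (p : DistDom.PortNumbering G) (ident : V → ℕ), Function.Injective ident →
          ∃ D : Finset V,
            A.ComputesWithin G p ident (C ε) D ∧
            DistDom.IsDominating G D ∧
            D.card ≤ (6 * nabla + 3) * DistDom.domNumber G := by
  obtain ⟨r, φ, hφ⟩ := DistDom.isLocal_selected nabla t
  -- The size bound has no ε-loss, so one constant number of rounds serves every ε.
  refine ⟨DistDom.viewAlgorithm r φ, fun _ => r, ?_⟩
  intro V _ G _ hfree hG _ _ p ident hident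
  exact ⟨DistDom.selected G nabla t,
    DistDom.viewAlgorithm_computesWithin G p ident fun v => iff_of_eq (hφ ⟨V, G, ident, hident⟩ v),
    DistDom.isDominating_selected G nabla t, DistDom.card_selected_le hnabla hG hfree⟩
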